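/- Let $k$ be a commutative integral domain. A twisting map $s\colon k[Y]\otimes k[X]\to k[X]\otimes k[Y]$ is a $k$-linear map with $s(1\otimes a)=a\otimes 1$ and $s(b\otimes 1)=1\otimes b$ for $a\in k[X]$, $b\in k[Y]$, such that, with $A=k[X]$, $B=k[Y]$ and multiplications $\mu_A,\mu_B$, $$s\circ(\mu_B\otimes A)=(A\otimes\mu_B)\circ(s\otimes B)\circ(B\otimes s),\qquad s\circ(B\otimes\mu_A)=(\mu_A\otimes B)\circ(A\otimes s)\circ(s\otimes A).$$ Let $\alpha_j\colon k[X]\to k[X]$ ($j\ge 0$) be the linear maps defined by $s(Y\otimes a)=\sum_j\alpha_j(a)\otimes Y^j$. The map $s$ is upper bounded if $\alpha_n=0$ for all sufficiently large $n$, and lower bounded if $\tau\circ s\circ\tau$ is upper bounded (with the roles of $X$ and $Y$ exchanged), where $\tau$ is the flip. An element $\lambda\in k$ is called a multiple root of $P\in k[Z]$ if $(Z-\lambda)^2$ divides $P$ (so every $\lambda$ is a multiple root of $P=0$). Let $\sum_{i,j} q'_{ij}X^i\otimes Y^j\in k[X]\otimes k[Y]$ (a finite sum), and put $Q_j(Z)=\sum_{m\ge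 0}q'_{mj}Z^m$ and $P_i(Z)=\sum_{n\ge 0}q'_{in}Z^n$. (1) If $q'_{i0}=0$ for all $i$ and $q'_{i1}=0$ for all $i\ge 1$, then there is an upper bounded twisting map $s'$ with $s'(Y\otimes X)=\sum_{i,j} q'_{ij}X^i\otimes Y^j$ if and only if $q'_{01}$ is a multiple root of $Q_j$ for each $j>1$. (2) If $q'_{0j}=0$ for all $j$ and $q'_{1j}=0$ for all $j\ge 1$, then there is a lower bounded twisting map $s'$ with $s'(Y\otimes X)=\sum_{i,j} q'_{ij}X^i\otimes Y^j$ if and only if $q'_{10}$ is a multiple root of $P_i$ for each $i>1$. (3) Item (1) gives all the upper bounded twisting maps with $\alpha_0=0$ and $\alpha_1$ the evaluation at an element of $k$. That is, for an upper bounded twisting map $s'$ with $s'(Y\otimes X)=\sum_{i,j} q'_{ij}X^i\otimes Y^j$ and for $c\in k$, one has $\alpha_0=0$ and $\alpha_1(P)=P(c)$ for all $P\in k[X]$ if and only if $q'_{i0}=0$ for all $i$, $q'_{i1}=0$ for all $i\ge1$ and $q'_{01}=c$. Moreover, for each $c\in k$, the map $s'\mapsto s'(Y\otimes X)$ is a bijection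 from the set of upper bounded twisting maps with $\alpha_0=0$ and $\alpha_1$ the evaluation at $c$ onto the set of those $\sum_{i,j} q'_{ij}X^i\otimes Y^j$ with $q'_{i0}=0$ for all $i$, $q'_{i1}=0$ for all $i\ge 1$, $q'_{01}=c$, and $c$ a multiple root of $Q_j$ for each $j>1$. -/

import Mathlib

open scoped TensorProduct Polynomial

/-- A twisting map `s : B ⊗ A → A ⊗ B` between two `k`-algebras: a `k`-linear map compatible
with the units and the multiplications of `A` and `B`. -/
structure IsTwistingMap {k A B : Type*} [CommRing k] [Ring A] [Algebra k A] [Ring B] [Algebra k B]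
    (s : B ⊗[k] A →ₗ[k] A ⊗[k] B) : Prop where
  one_left : ∀ a : A, s (1 ⊗ₜ[k] a) = a ⊗ₜ[k] 1
  one_right : ∀ b : B, s (b ⊗ₜ[k] 1) = 1 ⊗ₜ[k] b
  /-- `s ∘ (μ_B ⊗ A) = (A ⊗ μ_B) ∘ (s ⊗ B) ∘ (B ⊗ s)` on `B ⊗ B ⊗ A`. -/
  mul_left :
    s ∘ₗ (LinearMap.mul' k B).rTensor A =
      (LinearMap.mul' k B).lTensor A ∘ₗ (TensorProduct.assoc k A B B).toLinearMap ∘ₗ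
        s.rTensor B ∘ₗ (TensorProduct.assoc k B A B).symm.toLinearMap ∘ₗ
        s.lTensor B ∘ₗ (TensorProduct.assoc k B B A).toLinearMap
  /-- `s ∘ (B ⊗ μ_A) = (μ_A ⊗ B) ∘ (A ⊗ s) ∘ (s ⊗ A)` on `B ⊗ A ⊗ A`. -/
  mul_right :
    s ∘ₗ (LinearMap.mul' k A).lTensor B =
      (LinearMap.mul' k A).rTensor B ∘ₗ (TensorProduct.assoc k A A B).symm.toLinearMap ∘ₗ
        s.lTensor A ∘ₗ (TensorProduct.assoc k A B A).toLinearMap ∘ₗ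
        s.rTensor A ∘ₗ (TensorProduct.assoc k B A A).symm.toLinearMap

namespace TwistedPlane

/-! Both `k[X]` and `k[Y]` are the type `k[X]` of polynomials in one variable (whose variable is
`Polynomial.X`); they are told apart by their position. A map `k[Y] ⊗ k[X] → k[X] ⊗ k[Y]` has
`k[Y]` as first factor of its source and as second factor of its target. -/

variable {k : Type*} [CommRing k]

/-- The type of `k`-linear maps `k[Y] ⊗ k[X] → k[X] ⊗ k[Y]`. -/
abbrev PlaneMap (k : Type*) [CommRing k] : Type _ := k[X] ⊗[k] k[X] →ₗ[k] k[X] ⊗[k] k[X]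

/-- The map `k[X] ⊗ k[Y] → k[X]` taking the coefficient of `Y ^ j`, so `∑ aⱼ ⊗ Y ^ j ↦ aⱼ`. -/
noncomputable def coeffY (j : ℕ) : k[X] ⊗[k] k[X] →ₗ[k] k[X] :=
  (TensorProduct.rid k k[X]).toLinearMap ∘ₗ (Polynomial.lcoeff k j).lTensor k[X]

/-- The maps `αⱼ : k[X] → k[X]` determined by `s (Y ⊗ a) = ∑ⱼ αⱼ(a) ⊗ Y ^ j`. -/
noncomputable def alpha (s : PlaneMap k) (j : ℕ) : k[X] →ₗ[k] k[X] :=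
  coeffY j ∘ₗ s ∘ₗ TensorProduct.mk k k[X] k[X] Polynomial.X

theorem exists_eq_sum_coeffY (t : k[X] ⊗[k] k[X]) :
    ∃ n₀, ∀ n ≥ n₀, t = ∑ j ∈ Finset.range n, coeffY j t ⊗ₜ[k] (Polynomial.X ^ j : k[X]) := by
  induction t using TensorProduct.induction_on with
  | zero => exact ⟨0, fun n _ => by simp⟩
  | tmul a b =>
    refine ⟨b.natDegree + 1, fun n hn => ?_⟩
    conv_lhs => rw [b.as_sum_range' n (by omega)]
    simp [coeffY, TensorProduct.tmul_sum, TensorProduct.smul_tmul, ← Polynomial.smul_X_eq_monomial]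
  | add x y hx hy =>
    obtain ⟨m, hm⟩ := hx
    obtain ⟨n, hn⟩ := hy
    refine ⟨max m n, fun r hr => ?_⟩
    simp only [map_add, TensorProduct.add_tmul, Finset.sum_add_distrib]
    rw [← hm r (le_trans (le_max_left _ _) hr), ← hn r (le_trans (le_max_right _ _) hr)]

/-- The defining formula `s (Y ⊗ a) = ∑ⱼ αⱼ(a) ⊗ Y ^ j`, a finite sum for each `a`. -/
theorem apply_Y_tmul (s : PlaneMap k) (a : k[X]) :
    ∃ n₀, ∀ n ≥ n₀, s (Polynomial.X ⊗ₜ[k] a) =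
      ∑ j ∈ Finset.range n, alpha s j a ⊗ₜ[k] (Polynomial.X ^ j : k[X]) :=
  exists_eq_sum_coeffY _

/-- `s` is upper bounded: `αₙ = 0` for all large `n`. -/
def UpperBounded (s : PlaneMap k) : Prop :=
  ∃ n₀ : ℕ, ∀ n ≥ n₀, alpha s n = 0

/-- Conjugation `τ ∘ s ∘ τ` by the flip `τ`. -/
noncomputable def flipConj (s : PlaneMap k) : PlaneMap k :=
  (TensorProduct.comm k k[X] k[X]).toLinearMap ∘ₗ s ∘ₗ
    (TensorProduct.comm k k[X] k[X]).toLinearMap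

/-- `s` is lower bounded: `τ ∘ s ∘ τ` is upper bounded (the two variables having exchanged their
roles). -/
def LowerBounded (s : PlaneMap k) : Prop :=
  UpperBounded (flipConj s)

/-- The element `∑ qᵢⱼ Xⁱ ⊗ Yʲ` of `k[X] ⊗ k[Y]`, for finitely supported coefficients `q`. -/
noncomputable def tensorOf (q : ℕ × ℕ →₀ k) : k[X] ⊗[k] k[X] :=
  q.sum fun p c => c • ((Polynomial.X ^ p.1 : k[X]) ⊗ₜ[k] (Polynomial.X ^ p.2 : k[X]))

/-- `Q_j(Z) = ∑ₘ qₘⱼ Zᵐ`. -/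
noncomputable def colPoly (q : ℕ × ℕ →₀ k) (j : ℕ) : k[X] :=
  q.sum fun p c => if p.2 = j then Polynomial.monomial p.1 c else 0

/-- `P_i(Z) = ∑ₙ qᵢₙ Zⁿ`. -/
noncomputable def rowPoly (q : ℕ × ℕ →₀ k) (i : ℕ) : k[X] :=
  q.sum fun p c => if p.1 = i then Polynomial.monomial p.2 c else 0

theorem coeff_colPoly (q : ℕ × ℕ →₀ k) (j m : ℕ) : (colPoly q j).coeff m = q (m, j) := by
  classical
  rw [colPoly, Finsupp.sum, Polynomial.finsetSum_coeff, Finset.sum_eq_single (m, j)]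
  · simp
  · rintro ⟨a, b⟩ _ hne
    by_cases hb : b = j
    · have : a ≠ m := fun h => hne (by rw [h, hb])
      simp [hb, Polynomial.coeff_monomial, this]
    · simp [hb]
  · intro h
    simp [Finsupp.notMem_support_iff.mp h]

theorem coeff_rowPoly (q : ℕ × ℕ →₀ k) (i n : ℕ) : (rowPoly q i).coeff n = q (i, n) := by
  classical
  rw [rowPoly, Finsupp.sum, Polynomial.finsetSum_coeff, Finset.sum_eq_single (i, n)]
  · simp
  · rintro ⟨a, b⟩ _ hne
    by_cases ha : a = i
    · have : b ≠ n := fun h => hne (by rw [h, ha])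
      simp [ha, Polynomial.coeff_monomial, this]
    · simp [ha]
  · intro h
    simp [Finsupp.notMem_support_iff.mp h]

/-- `a` is a multiple root of `p`: `(Z - a)²` divides `p`. In particular, every `a` is a multiple
root of the zero polynomial. -/
def IsMultipleRoot (p : k[X]) (a : k) : Prop :=
  (Polynomial.X - Polynomial.C a) ^ 2 ∣ p

/-- `q_{i0} = 0` for all `i` and `q_{i1} = 0` for all `i ≥ 1`. -/
def UpperCond (q : ℕ × ℕ →₀ k) : Prop :=
  (∀ i, q (i, 0) = 0) ∧ ∀ i ≥ 1, q (i, 1) = 0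

/-- `q_{0j} = 0` for all `j` and `q_{1j} = 0` for all `j ≥ 1`. -/
def LowerCond (q : ℕ × ℕ →₀ k) : Prop :=
  (∀ j, q (0, j) = 0) ∧ ∀ j ≥ 1, q (1, j) = 0

/-- `α₀ = 0` and `α₁` is the evaluation at `c` (with values in `k ⊆ k[X]`). -/
def AlphaZeroEval (s : PlaneMap k) (c : k) : Prop :=
  alpha s 0 = 0 ∧ ∀ p : k[X], alpha s 1 p = Polynomial.C (p.eval c)

end TwistedPlane

/-! ### Twisting axioms on pure tensors -/

namespace TwistedPlane

open Polynomial

variable {k : Type*} [CommRing k]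

/-! Expand the first tensor factor around `c`: `s (p ⊗ a) = ∑ₘ (X - c)ᵐ ⊗ actₘ(p, a)`, with `act`
valued in `k[Y]` (`Y` names the variable of that factor). The axioms become `actₘ(p, ab) = ∑_{u+v=m}
act_v(act_u(p, a), b)` and `actₘ(pY, a) = ∑ⱼ actₘ(p, αⱼ(a)) Yʲ`, and the `j`-th coefficient of
`actₘ(Y, a)` is the `m`-th Taylor coefficient of `αⱼ(a)`.

Suppose `α₀(X) = 0` and `α₁(X) = c`. Boundedness forces double roots in two steps. If `e =
α_{v+2}(X)(c)` is the first nonzero such value, `act₀(·, X - c)` raises the `Y`-adic order by `v +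
1` and multiplies the lowest coefficient by `e`; iterating from `Y` puts `eᵐ` in degree `m(v+1)+1`,
where `α` eventually vanishes (`eval_alpha_X_eq_zero`). Hence `act₀(·, X - c) = 0`, and `act₁(·, X -
c)` becomes substitution `Y ↦ w`, the coefficients of `w` being the derivatives `α_{j+2}(X)'(c)`. If
`w ≠ 0`, then `deg w ≥ 2` and the iterates have degree `(deg w)ᵐ`, again against boundedness
(`eval_derivative_alpha_X_eq_zero`).

Conversely, double roots make the explicit map `evalTwist` a twisting map. A `Y`-adic approximation
argument gives uniqueness, and the flip exchanges the upper and lower statements. -/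

/-- For fixed `p`, the map `a ⊗ r ↦ s (p ⊗ a) (1 ⊗ r)`. -/
noncomputable def leftStep (s : PlaneMap k) (p : k[X]) : PlaneMap k :=
  TensorProduct.lift <| LinearMap.flip <|
    ((LinearMap.mul k (k[X] ⊗[k] k[X])).comp (TensorProduct.mk k k[X] k[X] 1)).compl₂
      (s ∘ₗ TensorProduct.mk k k[X] k[X] p)

/-- For fixed `b`, the map `a ⊗ p ↦ (a ⊗ 1) s (p ⊗ b)`. -/
noncomputable def rightStep (s : PlaneMap k) (b : k[X]) : PlaneMap k :=
  TensorProduct.lift <|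
    ((LinearMap.mul k (k[X] ⊗[k] k[X])).comp ((TensorProduct.mk k k[X] k[X]).flip 1)).compl₂
      (s ∘ₗ (TensorProduct.mk k k[X] k[X]).flip b)

@[simp]
theorem leftStep_tmul (s : PlaneMap k) (p a r : k[X]) :
    leftStep s p (a ⊗ₜ r) = (1 ⊗ₜ r) * s (p ⊗ₜ a) := by
  simp [leftStep]

@[simp]
theorem rightStep_tmul (s : PlaneMap k) (b a p : k[X]) :
    rightStep s b (a ⊗ₜ p) = (a ⊗ₜ 1) * s (p ⊗ₜ b) := by
  simp [rightStep]

/-- Commutativity of `k[Y]` allows `leftStep` to put the factor `r` on the left. -/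
theorem mul_left_rhs (s : PlaneMap k) (p r a : k[X]) :
    ((LinearMap.mul' k k[X]).lTensor k[X] ∘ₗ
        (TensorProduct.assoc k k[X] k[X] k[X]).toLinearMap ∘ₗ
        s.rTensor k[X] ∘ₗ (TensorProduct.assoc k k[X] k[X] k[X]).symm.toLinearMap ∘ₗ
        s.lTensor k[X] ∘ₗ (TensorProduct.assoc k k[X] k[X] k[X]).toLinearMap)
      ((p ⊗ₜ r) ⊗ₜ a) = leftStep s p (s (r ⊗ₜ a)) := by
  simp only [LinearMap.comp_apply, LinearEquiv.coe_coe, TensorProduct.assoc_tmul,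
    LinearMap.lTensor_tmul]
  generalize s (r ⊗ₜ a) = t
  induction t using TensorProduct.induction_on with
  | zero => simp
  | add x y hx hy => simp only [TensorProduct.tmul_add, map_add, hx, hy]
  | tmul a' r' =>
    simp only [TensorProduct.assoc_symm_tmul, LinearMap.rTensor_tmul, leftStep_tmul]
    generalize s (p ⊗ₜ a') = t
    induction t using TensorProduct.induction_on with
    | zero => simp
    | add x y hx hy => simp only [TensorProduct.add_tmul, map_add, hx, hy, mul_add]
    | tmul a'' p' => simp [mul_comm]

theorem mul_right_rhs (s : PlaneMap k) (p a b : k[X]) :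
    ((LinearMap.mul' k k[X]).rTensor k[X] ∘ₗ
        (TensorProduct.assoc k k[X] k[X] k[X]).symm.toLinearMap ∘ₗ
        s.lTensor k[X] ∘ₗ (TensorProduct.assoc k k[X] k[X] k[X]).toLinearMap ∘ₗ
        s.rTensor k[X] ∘ₗ (TensorProduct.assoc k k[X] k[X] k[X]).symm.toLinearMap)
      (p ⊗ₜ (a ⊗ₜ b)) = rightStep s b (s (p ⊗ₜ a)) := by
  simp only [LinearMap.comp_apply, LinearEquiv.coe_coe, TensorProduct.assoc_symm_tmul,
    LinearMap.rTensor_tmul]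
  generalize s (p ⊗ₜ a) = t
  induction t using TensorProduct.induction_on with
  | zero => simp
  | add x y hx hy => simp only [TensorProduct.add_tmul, map_add, hx, hy]
  | tmul a' p' =>
    simp only [TensorProduct.assoc_tmul, LinearMap.lTensor_tmul, rightStep_tmul]
    generalize s (p' ⊗ₜ b) = t
    induction t using TensorProduct.induction_on with
    | zero => simp
    | add x y hx hy => simp only [TensorProduct.tmul_add, map_add, hx, hy, mul_add]
    | tmul a'' p' => simp

theorem isTwistingMap_iff (s : PlaneMap k) : IsTwistingMap s ↔
    (∀ a : k[X], s (1 ⊗ₜ a) = a ⊗ₜ 1) ∧ (∀ p : k[X], s (p ⊗ₜ 1) = 1 ⊗ₜ p) ∧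
    (∀ p r a : k[X], s ((p * r) ⊗ₜ a) = leftStep s p (s (r ⊗ₜ a))) ∧
    (∀ p a b : k[X], s (p ⊗ₜ (a * b)) = rightStep s b (s (p ⊗ₜ a))) := by
  constructor
  · rintro ⟨h1, h2, h3, h4⟩
    refine ⟨h1, h2, fun p r a => ?_, fun p a b => ?_⟩
    · rw [← mul_left_rhs, ← h3]; simp
    · rw [← mul_right_rhs, ← h4]; simp
  · rintro ⟨h1, h2, h3, h4⟩
    refine ⟨h1, h2, ?_, ?_⟩
    · refine TensorProduct.ext_threefold fun p r a => ?_
      rw [mul_left_rhs, ← h3]; simp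
    · refine TensorProduct.ext_threefold' fun p a b => ?_
      rw [mul_right_rhs, ← h4]; simp

/-! ### Exchanging the two variables -/

@[simp]
theorem flipConj_tmul (s : PlaneMap k) (a b : k[X]) :
    flipConj s (a ⊗ₜ b) = TensorProduct.comm k k[X] k[X] (s (b ⊗ₜ a)) := by
  simp [flipConj]

theorem flipConj_flipConj (s : PlaneMap k) : flipConj (flipConj s) = s := by
  refine TensorProduct.ext' fun a b => ?_
  simp

theorem comm_mul (x y : k[X] ⊗[k] k[X]) :
    TensorProduct.comm k k[X] k[X] (x * y) =
      TensorProduct.comm k k[X] k[X] x * TensorProduct.comm k k[X] k[X] y :=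
  map_mul (Algebra.TensorProduct.comm k k[X] k[X]) x y

theorem leftStep_flipConj (s : PlaneMap k) (p : k[X]) (t : k[X] ⊗[k] k[X]) :
    leftStep (flipConj s) p (TensorProduct.comm k k[X] k[X] t) =
      TensorProduct.comm k k[X] k[X] (rightStep s p t) := by
  induction t using TensorProduct.induction_on with
  | zero => simp
  | add x y hx hy => simp only [map_add, hx, hy]
  | tmul a r => simp [comm_mul]

theorem rightStep_flipConj (s : PlaneMap k) (b : k[X]) (t : k[X] ⊗[k] k[X]) :
    rightStep (flipConj s) b (TensorProduct.comm k k[X] k[X] t) =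
      TensorProduct.comm k k[X] k[X] (leftStep s b t) := by
  induction t using TensorProduct.induction_on with
  | zero => simp
  | add x y hx hy => simp only [map_add, hx, hy]
  | tmul a r => simp [comm_mul]

theorem _root_.IsTwistingMap.flipConj {s : PlaneMap k} (hs : IsTwistingMap s) :
    IsTwistingMap (flipConj s) := by
  obtain ⟨h1, h2, h3, h4⟩ := (isTwistingMap_iff s).1 hs
  refine (isTwistingMap_iff _).2 ⟨fun a => by simp [h2], fun p => by simp [h1],
    fun p r a => ?_, fun p a b => ?_⟩
  · rw [flipConj_tmul, flipConj_tmul, leftStep_flipConj, mul_comm, h4]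
  · rw [flipConj_tmul, flipConj_tmul, rightStep_flipConj, mul_comm, h3]

/-! ### Coefficients of tensors -/

@[simp]
theorem coeffY_tmul (j : ℕ) (a p : k[X]) : coeffY j (a ⊗ₜ[k] p) = p.coeff j • a := by
  simp [coeffY]

theorem eq_of_coeffY_eq {t t' : k[X] ⊗[k] k[X]} (h : ∀ j, coeffY j t = coeffY j t') :
    t = t' := by
  obtain ⟨m, hm⟩ := exists_eq_sum_coeffY t
  obtain ⟨n, hn⟩ := exists_eq_sum_coeffY t'
  rw [hm _ (le_max_left m n), hn _ (le_max_right m n)]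
  simp only [h]

theorem coeffY_tensorOf (q : ℕ × ℕ →₀ k) (j : ℕ) : coeffY j (tensorOf q) = colPoly q j := by
  simp only [tensorOf, colPoly, Finsupp.sum, map_sum, map_smul, coeffY_tmul, coeff_X_pow]
  refine Finset.sum_congr rfl fun p _ => ?_
  by_cases h : p.2 = j
  · simp [h, smul_X_eq_monomial]
  · simp [h, Ne.symm h]

theorem exists_eq_tensorOf (t : k[X] ⊗[k] k[X]) : ∃ q : ℕ × ℕ →₀ k, t = tensorOf q := by
  let f : (ℕ × ℕ →₀ k) →ₗ[k] k[X] ⊗[k] k[X] :=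
    Finsupp.linearCombination k fun p => ((X ^ p.1 : k[X]) ⊗ₜ[k] (X ^ p.2 : k[X]))
  suffices h : t ∈ LinearMap.range f by
    obtain ⟨q, hq⟩ := h
    exact ⟨q, hq.symm⟩
  have hm : ∀ i j : ℕ, (X ^ i : k[X]) ⊗ₜ[k] (X ^ j : k[X]) ∈ LinearMap.range f :=
    fun i j => ⟨Finsupp.single (i, j) 1, by simp [f]⟩
  induction t using TensorProduct.induction_on with
  | zero => exact zero_mem _
  | add x y hx hy => exact add_mem hx hy
  | tmul a b =>
    rw [a.as_sum_range_C_mul_X_pow, b.as_sum_range_C_mul_X_pow, TensorProduct.sum_tmul]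
    refine sum_mem fun i _ => ?_
    rw [TensorProduct.tmul_sum]
    refine sum_mem fun j _ => ?_
    rw [← smul_eq_C_mul, ← smul_eq_C_mul, TensorProduct.smul_tmul_smul]
    exact Submodule.smul_mem _ _ (hm i j)

theorem comm_tensorOf (q : ℕ × ℕ →₀ k) :
    TensorProduct.comm k k[X] k[X] (tensorOf q) =
      tensorOf (q.mapDomain Prod.swap) := by
  classical
  rw [tensorOf, tensorOf, Finsupp.sum_mapDomain_index (by simp) (by simp [add_smul])]
  simp [Finsupp.sum]

theorem mapDomain_swap_apply (q : ℕ × ℕ →₀ k) (i j : ℕ) :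
    q.mapDomain Prod.swap (i, j) = q (j, i) :=
  Finsupp.mapDomain_apply (Prod.swap_injective) q (j, i)

theorem colPoly_mapDomain_swap (q : ℕ × ℕ →₀ k) (j : ℕ) :
    colPoly (q.mapDomain Prod.swap) j = rowPoly q j := by
  ext m
  rw [coeff_colPoly, coeff_rowPoly, mapDomain_swap_apply]

/-! ### Taylor slices at `c` -/

/-- The functional taking the `m`-th coefficient of the expansion of a polynomial around `c`. -/
noncomputable def tCoeff (c : k) (m : ℕ) : k[X] →ₗ[k] k :=
  lcoeff k m ∘ₗ taylor c

theorem tCoeff_apply (c : k) (m : ℕ) (a : k[X]) : tCoeff c m a = (taylor c a).coeff m := rfl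

@[simp]
theorem tCoeff_zero (c : k) (a : k[X]) : tCoeff c 0 a = a.eval c := by
  simp [tCoeff_apply]

@[simp]
theorem tCoeff_one (c : k) (a : k[X]) : tCoeff c 1 a = (derivative a).eval c := by
  simp [tCoeff_apply]

@[simp]
theorem tCoeff_C (c : k) (m : ℕ) (b : k) : tCoeff c m (C b) = if m = 0 then b else 0 := by
  simp [tCoeff_apply, coeff_C]

theorem tCoeff_mul (c : k) (m : ℕ) (a b : k[X]) :
    tCoeff c m (a * b) = ∑ u ∈ Finset.HasAntidiagonal.antidiagonal m, tCoeff c u.1 a * tCoeff c u.2 b := by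
  simp [tCoeff_apply, taylor_mul, coeff_mul]

theorem eq_of_tCoeff_eq {c : k} {a b : k[X]} (h : ∀ m, tCoeff c m a = tCoeff c m b) : a = b :=
  taylor_injective c (Polynomial.ext h)

/-- The map `a ⊗ p ↦ aₘ p`, where `aₘ` is the `m`-th coefficient of `a` around `c`. -/
noncomputable def slice (c : k) (m : ℕ) : k[X] ⊗[k] k[X] →ₗ[k] k[X] :=
  (TensorProduct.lid k k[X]).toLinearMap ∘ₗ (tCoeff c m).rTensor k[X]

@[simp]
theorem slice_tmul (c : k) (m : ℕ) (a p : k[X]) : slice c m (a ⊗ₜ p) = tCoeff c m a • p := by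
  simp [slice]

theorem slice_one_tmul_mul (c : k) (m : ℕ) (r : k[X]) (t : k[X] ⊗[k] k[X]) :
    slice c m ((1 ⊗ₜ r) * t) = r * slice c m t := by
  induction t using TensorProduct.induction_on with
  | zero => simp
  | add x y hx hy => simp only [mul_add, map_add, hx, hy]
  | tmul a p => simp

theorem slice_tmul_one_mul (c : k) (m : ℕ) (a : k[X]) (t : k[X] ⊗[k] k[X]) :
    slice c m ((a ⊗ₜ 1) * t) =
      ∑ u ∈ Finset.HasAntidiagonal.antidiagonal m, tCoeff c u.1 a • slice c u.2 t := by
  induction t using TensorProduct.induction_on with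
  | zero => simp
  | add x y hx hy => simp only [mul_add, map_add, hx, hy, smul_add, Finset.sum_add_distrib]
  | tmul b p => simp [tCoeff_mul, Finset.sum_smul, mul_smul]

theorem coeff_slice (c : k) (m j : ℕ) (t : k[X] ⊗[k] k[X]) :
    (slice c m t).coeff j = tCoeff c m (coeffY j t) := by
  induction t using TensorProduct.induction_on with
  | zero => simp
  | add x y hx hy => simp only [map_add, coeff_add, hx, hy]
  | tmul b p => simp [mul_comm]

theorem eq_of_slice_eq {c : k} {t t' : k[X] ⊗[k] k[X]} (h : ∀ m, slice c m t = slice c m t') :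
    t = t' :=
  eq_of_coeffY_eq fun j => eq_of_tCoeff_eq (c := c) fun m => by
    rw [← coeff_slice, h, coeff_slice]

/-- The bilinear map `(p, a) ↦ slice c m (s (p ⊗ a))`. -/
noncomputable def act (s : PlaneMap k) (c : k) (m : ℕ) : k[X] →ₗ[k] k[X] →ₗ[k] k[X] :=
  (TensorProduct.mk k k[X] k[X]).compr₂ (slice c m ∘ₗ s)

theorem act_apply (s : PlaneMap k) (c : k) (m : ℕ) (p a : k[X]) :
    act s c m p a = slice c m (s (p ⊗ₜ a)) := rfl

theorem coeff_act_X (s : PlaneMap k) (c : k) (m j : ℕ) (a : k[X]) :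
    (act s c m X a).coeff j = tCoeff c m (alpha s j a) :=
  coeff_slice c m j _

section

variable {s : PlaneMap k} (hs : IsTwistingMap s) (c : k)
include hs

theorem act_one_left (m : ℕ) (a : k[X]) : act s c m 1 a = C (tCoeff c m a) := by
  rw [act_apply, hs.one_left, slice_tmul, smul_eq_C_mul, mul_one]

theorem act_C_right (m : ℕ) (p : k[X]) (b : k) :
    act s c m p (C b) = if m = 0 then b • p else 0 := by
  have h : (C b : k[X]) = b • 1 := by rw [smul_eq_C_mul, mul_one]
  have h1 := tCoeff_C c m (1 : k)
  rw [C_1] at h1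
  rw [h, map_smul, act_apply, hs.one_right, slice_tmul, h1]
  split_ifs <;> simp

/-- Taylor coefficients of a product form a Cauchy product. For `m = 0` this is a right action of
`k[X]` on `k[Y]`. -/
theorem act_mul_right (m : ℕ) (p a b : k[X]) :
    act s c m p (a * b) =
      ∑ u ∈ Finset.HasAntidiagonal.antidiagonal m, act s c u.2 (act s c u.1 p a) b := by
  rw [act_apply, ((isTwistingMap_iff s).1 hs).2.2.2]
  simp only [act_apply]
  generalize s (p ⊗ₜ a) = t
  induction t using TensorProduct.induction_on with
  | zero => simp
  | add x y hx hy =>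
    simp only [map_add, TensorProduct.add_tmul, hx, hy, Finset.sum_add_distrib]
  | tmul a' p' =>
    simp [slice_tmul_one_mul, ← TensorProduct.smul_tmul']

theorem act_mul_X (m : ℕ) (p a : k[X]) :
    ∃ n₀, ∀ n ≥ n₀, act s c m (p * X) a =
      ∑ j ∈ Finset.range n, act s c m p (alpha s j a) * X ^ j := by
  obtain ⟨n₀, h⟩ := apply_Y_tmul s a
  refine ⟨n₀, fun n hn => ?_⟩
  rw [act_apply, ((isTwistingMap_iff s).1 hs).2.2.1, h n hn]
  simp [slice_one_tmul_mul, act_apply, mul_comm]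

end

end TwistedPlane

namespace TwistedPlane

open Polynomial

/-! ### Determination of `α₀` and `α₁` by their values at `X` -/

section

variable {k : Type*} [CommRing k] {s : PlaneMap k} (hs : IsTwistingMap s) {c : k}
include hs

/-- Peel off one factor `Y` at a time: the term `j = 0` of `act_mul_X` vanishes, and every other
term keeps a factor `Y`. -/
theorem X_pow_dvd_act (h0 : alpha s 0 = 0) (n m : ℕ) {p : k[X]} (a : k[X]) (hp : X ^ n ∣ p) :
    X ^ n ∣ act s c m p a := by
  induction n generalizing p a with
  | zero => simp
  | succ n ih =>
    obtain ⟨q, rfl⟩ := hp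
    obtain ⟨n₀, h⟩ := act_mul_X hs c m (X ^ n * q) a
    rw [show X ^ (n + 1) * q = X ^ n * q * X by ring, h n₀ le_rfl]
    refine Finset.dvd_sum fun j _ => ?_
    rcases j with _ | j
    · simp [h0]
    · rw [pow_succ]
      exact mul_dvd_mul (ih _ (dvd_mul_right _ _)) (dvd_pow_self _ (by omega))

/-- The term `j = 1` of `act_mul_X` at `X` is the contribution of the constant `c`, so passing to `X
- C c` cancels it and the sum starts at `Y²`. -/
theorem act_mul_X_sub (hX0 : alpha s 0 X = 0) (hX1 : alpha s 1 X = C c) (m : ℕ) (p : k[X]) :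
    ∃ n₀, ∀ n ≥ n₀, act s c m (p * X) (X - C c) =
      ∑ j ∈ Finset.range n, act s c m p (alpha s (j + 2) X) * X ^ (j + 2) := by
  obtain ⟨n₀, h⟩ := act_mul_X hs c m p X
  refine ⟨n₀, fun n hn => ?_⟩
  rw [map_sub, h (n + 2) (by omega), Finset.sum_range_succ', Finset.sum_range_succ', hX0,
    act_C_right hs]
  simp only [zero_add, hX1, act_C_right hs]
  split_ifs <;> simp [add_assoc]

theorem X_pow_two_dvd_act_mul_X_sub (hX0 : alpha s 0 X = 0) (hX1 : alpha s 1 X = C c) (m : ℕ)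
    (p : k[X]) : X ^ 2 ∣ act s c m (p * X) (X - C c) := by
  obtain ⟨n₀, h⟩ := act_mul_X_sub hs hX0 hX1 m p
  rw [h n₀ le_rfl]
  exact Finset.dvd_sum fun j _ => Dvd.dvd.mul_left (pow_dvd_pow _ (by omega)) _

theorem X_dvd_act_X (hX0 : alpha s 0 X = 0) (hX1 : alpha s 1 X = C c) (m : ℕ) {p : k[X]}
    (hp : X ∣ p) : X ∣ act s c m p X := by
  obtain ⟨q, rfl⟩ := hp
  have h := X_pow_two_dvd_act_mul_X_sub hs hX0 hX1 m q
  rw [map_sub, act_C_right hs] at h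
  rw [mul_comm X q]
  have h' : (X : k[X]) ∣ if m = 0 then c • (q * X) else 0 := by
    split_ifs
    · exact Dvd.intro_left (c • q) (smul_mul_assoc _ _ _)
    · exact dvd_zero _
  have := ((dvd_pow_self X two_ne_zero).trans h).add h'
  simpa using this

theorem coeff_one_act_X (hX0 : alpha s 0 X = 0) (hX1 : alpha s 1 X = C c) (m : ℕ) {p : k[X]}
    (hp : X ∣ p) : (act s c m p X).coeff 1 = if m = 0 then c * p.coeff 1 else 0 := by
  obtain ⟨q, rfl⟩ := hp
  have h := X_pow_dvd_iff.1 (X_pow_two_dvd_act_mul_X_sub hs hX0 hX1 m q) 1 one_lt_two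
  rw [map_sub, act_C_right hs, coeff_sub, sub_eq_zero] at h
  rw [mul_comm X q, h]
  split_ifs <;> simp

theorem alpha_zero_eq_zero (hX0 : alpha s 0 X = 0) (hX1 : alpha s 1 X = C c) :
    alpha s 0 = 0 := by
  have h : ∀ (a : k[X]) (m : ℕ), X ∣ act s c m X a := by
    intro a
    induction a using Polynomial.induction_on with
    | C b =>
      intro m
      rw [act_C_right hs]
      split_ifs
      · exact Dvd.intro_left (C b) (smul_eq_C_mul _).symm
      · exact dvd_zero _
    | add a b ha hb => exact fun m => by rw [map_add]; exact (ha m).add (hb m)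
    | monomial n b ih =>
      intro m
      rw [pow_succ, ← mul_assoc, act_mul_right hs]
      exact Finset.dvd_sum fun u _ => X_dvd_act_X hs hX0 hX1 _ (ih _)
  refine LinearMap.ext fun a => ?_
  refine eq_of_tCoeff_eq (c := c) fun m => ?_
  rw [← coeff_act_X, X_dvd_iff.1 (h _ m)]
  simp

theorem alpha_one_eq_eval (hX0 : alpha s 0 X = 0) (hX1 : alpha s 1 X = C c) (a : k[X]) :
    alpha s 1 a = C (a.eval c) := by
  have h0 := alpha_zero_eq_zero hs hX0 hX1
  -- The linear coefficient of `act` at `X` only sees the linear coefficient of its argument, so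
  -- only the pair `(m, 0)` survives in the Cauchy product.
  have hmul : ∀ a : k[X], alpha s 1 (a * X) = C c * alpha s 1 a := by
    intro a
    refine eq_of_tCoeff_eq (c := c) fun m => ?_
    rw [← smul_eq_C_mul, map_smul, ← coeff_act_X, ← coeff_act_X, act_mul_right hs, finsetSum_coeff]
    have hX : ∀ u, X ∣ act s c u X a := fun u => by
      have h := X_pow_dvd_act hs h0 1 u (c := c) (p := X) a (pow_one X).dvd
      rwa [pow_one] at h
    rw [Finset.sum_congr rfl fun u _ => coeff_one_act_X hs hX0 hX1 u.2 (hX u.1),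
      Finset.sum_eq_single (m, 0)]
    · simp
    · rintro ⟨u, v⟩ huv hne
      rw [if_neg]
      rintro rfl
      exact hne (by simpa using huv)
    · simp
  induction a using Polynomial.induction_on with
  | C b =>
    refine eq_of_tCoeff_eq (c := c) fun m => ?_
    rw [← coeff_act_X, act_C_right hs]
    split_ifs with h <;> simp [h]
  | add a b ha hb => simp [ha, hb]
  | monomial n b ih => rw [pow_succ, ← mul_assoc, hmul, ih, eval_mul_X, C_mul, mul_comm]

theorem act_zero_mul (p a b : k[X]) :
    act s c 0 p (a * b) = act s c 0 (act s c 0 p a) b := by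
  simp [act_mul_right hs]

theorem act_zero_of_eval_eq_zero (p : k[X]) {a : k[X]} (ha : a.eval c = 0) :
    ∃ b, act s c 0 p a = act s c 0 (act s c 0 p (X - C c)) b := by
  obtain ⟨b, rfl⟩ := dvd_iff_isRoot.2 ha
  exact ⟨b, act_zero_mul hs _ _ _⟩

theorem act_zero_eq (p a : k[X]) :
    ∃ b, act s c 0 p a = a.eval c • p + act s c 0 (act s c 0 p (X - C c)) b := by
  obtain ⟨b, hb⟩ := act_zero_of_eval_eq_zero hs p (c := c) (a := a - C (a.eval c)) (by simp)
  refine ⟨b, ?_⟩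
  rw [← hb, map_sub, act_C_right hs]
  simp

end

/-! ### Consequences of upper boundedness -/

section

variable {k : Type*} [CommRing k] [IsDomain k] {s : PlaneMap k} (hs : IsTwistingMap s) {c : k}
include hs

theorem X_pow_dvd_act_X_sub (h0 : alpha s 0 = 0) (hX1 : alpha s 1 X = C c) {v : ℕ}
    (hv : ∀ j < v, (alpha s (j + 2) X).eval c = 0) (p : k[X]) :
    ∀ n, X ^ n ∣ p → X ^ (n + v + 1) ∣ act s c 0 p (X - C c) := by
  have hX0 : alpha s 0 X = 0 := by simp [h0]
  induction p using Polynomial.recOnHorner with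
  | M0 => simp
  | MC p a hp ha ih =>
    intro n hn
    have h : act s c 0 (C a) (X - C c) = 0 := by
      rw [← mul_one (C a), ← smul_eq_C_mul, map_smul, LinearMap.smul_apply, act_one_left hs]
      simp
    rw [map_add, LinearMap.add_apply, h, add_zero]
    refine ih n ?_
    rcases n with _ | n
    · simp
    · have := X_dvd_iff.1 ((dvd_pow_self X n.succ_ne_zero).trans hn)
      simp [hp, ha] at this
  | MX p _ ih =>
    intro n hn
    obtain ⟨n₀, h⟩ := act_mul_X_sub hs hX0 hX1 0 p
    rw [h n₀ le_rfl]
    -- For `n = 0` the truncated subtraction gives the trivial divisibility, which suffices for the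
    -- exponent counts below.
    have hn' : X ^ (n - 1) ∣ p := by
      rcases n with _ | n
      · simp
      · rw [pow_succ] at hn
        exact (mul_dvd_mul_iff_right X_ne_zero).1 hn
    refine Finset.dvd_sum fun j _ => ?_
    by_cases hj : j < v
    · obtain ⟨b, hb⟩ := act_zero_of_eval_eq_zero hs p (hv j hj)
      rw [hb]
      refine (pow_dvd_pow X (show n + v + 1 ≤ (n - 1 + v + 1) + (j + 2) by omega)).trans ?_
      rw [pow_add]
      exact mul_dvd_mul_right (X_pow_dvd_act hs h0 _ _ _ (ih _ hn')) _
    · refine (pow_dvd_pow X (show n + v + 1 ≤ (n - 1) + (j + 2) by omega)).trans ?_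
      rw [pow_add]
      exact mul_dvd_mul_right (X_pow_dvd_act hs h0 _ _ _ hn') _

/-- After writing the argument as `pY`, only `j = v` reaches this degree: for `j < v` the action
gains order through `X - C c`, and for `j > v` the factor `Y ^ (j + 2)` is already too large. -/
theorem coeff_act_X_sub (h0 : alpha s 0 = 0) (hX1 : alpha s 1 X = C c) {v : ℕ}
    (hv : ∀ j < v, (alpha s (j + 2) X).eval c = 0) {p : k[X]} {n : ℕ} (hp : X ^ (n + 1) ∣ p) :
    (act s c 0 p (X - C c)).coeff (n + 1 + (v + 1)) =
      (alpha s (v + 2) X).eval c * p.coeff (n + 1) := by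
  have hX0 : alpha s 0 X = 0 := by simp [h0]
  obtain ⟨p, rfl⟩ := (dvd_pow_self X n.succ_ne_zero).trans hp
  rw [mul_comm X p] at hp ⊢
  have hn : X ^ n ∣ p := by
    rw [pow_succ] at hp
    exact (mul_dvd_mul_iff_right X_ne_zero).1 hp
  have hU := X_pow_dvd_act_X_sub hs h0 hX1 hv p n hn
  obtain ⟨n₀, h⟩ := act_mul_X_sub hs hX0 hX1 0 p
  rw [h (n₀ + v + 1) (by omega), finsetSum_coeff, Finset.sum_eq_single v, coeff_mul_X]
  · rw [show n + 1 + (v + 1) = n + (v + 2) by omega, coeff_mul_X_pow]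
    obtain ⟨b, hb⟩ := act_zero_eq hs p (c := c) (alpha s (v + 2) X)
    rw [hb, coeff_add, coeff_smul, smul_eq_mul,
      X_pow_dvd_iff.1 (X_pow_dvd_act hs h0 _ _ _ hU) n (by omega), add_zero]
  · intro j _ hne
    rcases lt_or_gt_of_ne hne with hj | hj
    · obtain ⟨b, hb⟩ := act_zero_of_eval_eq_zero hs p (hv j hj)
      rw [hb]
      refine X_pow_dvd_iff.1 (?_ : X ^ (n + v + 1 + (j + 2)) ∣ _) _ (by omega)
      rw [pow_add]
      exact mul_dvd_mul_right (X_pow_dvd_act hs h0 _ _ _ hU) _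
    · refine X_pow_dvd_iff.1 (?_ : X ^ (n + (j + 2)) ∣ _) _ (by omega)
      rw [pow_add]
      exact mul_dvd_mul_right (X_pow_dvd_act hs h0 _ _ _ hn) _
  · intro h'
    simp at h'

theorem eval_alpha_X_eq_zero (hb : UpperBounded s) (h0 : alpha s 0 = 0)
    (hX1 : alpha s 1 X = C c) (j : ℕ) : (alpha s (j + 2) X).eval c = 0 := by
  induction j using Nat.strong_induction_on with
  | _ v hv =>
    obtain ⟨N, hN⟩ := hb
    have key : ∀ m, X ^ (m * (v + 1) + 1) ∣ act s c 0 X ((X - C c) ^ m) ∧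
        (act s c 0 X ((X - C c) ^ m)).coeff (m * (v + 1) + 1) =
          (alpha s (v + 2) X).eval c ^ m := by
      intro m
      induction m with
      | zero =>
        have h := act_C_right hs c 0 X 1
        simp only [C_1, if_true, one_smul] at h
        simp [h]
      | succ m ih =>
        have e : (m + 1) * (v + 1) + 1 = m * (v + 1) + 1 + (v + 1) := by ring
        rw [pow_succ (X - C c), act_zero_mul hs, e]
        exact ⟨X_pow_dvd_act_X_sub hs h0 hX1 hv _ _ ih.1,
          by rw [coeff_act_X_sub hs h0 hX1 hv ih.1, ih.2, pow_succ']⟩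
    -- The degree `N * (v + 1) + 1` is at least `N`, so boundedness kills this coefficient.
    have h := (key N).2
    rw [coeff_act_X, hN _ (by nlinarith)] at h
    simp only [LinearMap.zero_apply, map_zero] at h
    exact eq_zero_of_pow_eq_zero h.symm

theorem act_zero_X_sub (hb : UpperBounded s) (h0 : alpha s 0 = 0) (hX1 : alpha s 1 X = C c)
    (p : k[X]) : act s c 0 p (X - C c) = 0 := by
  -- The order bound holds for every `v`; taking `v = n` kills the coefficient of degree `n`.
  ext n
  exact X_pow_dvd_iff.1 (X_pow_dvd_act_X_sub hs h0 hX1 (v := n)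
    (fun j _ => eval_alpha_X_eq_zero hs hb h0 hX1 j) p 0 (by simp)) n (by omega)

theorem act_one_of_eval_eq_zero (hb : UpperBounded s) (h0 : alpha s 0 = 0)
    (hX1 : alpha s 1 X = C c) (p : k[X]) {a : k[X]} (ha : a.eval c = 0) :
    act s c 1 p a = C ((derivative a).eval c) * act s c 1 p (X - C c) := by
  obtain ⟨b, rfl⟩ := dvd_iff_isRoot.2 ha
  obtain ⟨d, hd⟩ := act_zero_eq hs (act s c 1 p (X - C c)) (c := c) b
  rw [act_mul_right hs, Finset.Nat.antidiagonal_succ]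
  simp [-map_sub, act_zero_X_sub hs hb h0 hX1, hd, smul_eq_C_mul]

/-- Replacing the argument `p` by `pY` multiplies `act₁(p, X - c)` by the same `w` each time, and
constants are fixed; hence the map is a substitution. Boundedness makes `w` a polynomial. -/
theorem act_one_X_sub (hb : UpperBounded s) (h0 : alpha s 0 = 0) (hX1 : alpha s 1 X = C c) :
    ∃ w : k[X], (∀ j, w.coeff (j + 2) = (derivative (alpha s (j + 2) X)).eval c) ∧
      ∀ p, act s c 1 p (X - C c) = p.comp w := by
  have hX0 : alpha s 0 X = 0 := by simp [h0]
  have hb' := hb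
  obtain ⟨N, hN⟩ := hb
  let f : ℕ → k[X] := fun j => C ((derivative (alpha s (j + 2) X)).eval c) * X ^ (j + 2)
  have hf : ∀ j ≥ N, f j = 0 := fun j hj => by simp [f, hN (j + 2) (by omega)]
  have hw : ∀ n ≥ N, ∑ j ∈ Finset.range n, f j = ∑ j ∈ Finset.range N, f j := fun n hn =>
    (Finset.sum_subset (Finset.range_mono hn) fun j _ hj => hf j (by simpa using hj)).symm
  refine ⟨∑ j ∈ Finset.range N, f j, fun j => ?_, fun p => ?_⟩
  · rw [← hw (N + j + 1) (by omega), finsetSum_coeff, Finset.sum_eq_single j]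
    · simp [f]
    · intro i _ hi
      simp [f, coeff_X_pow, Ne.symm hi]
    · intro h
      simp at h
  · induction p using Polynomial.induction_on with
    | C b =>
      rw [← mul_one (C b), ← smul_eq_C_mul, map_smul, LinearMap.smul_apply, act_one_left hs]
      simp
    | add p r hp hr => simp [hp, hr]
    | monomial n b ih =>
      rw [pow_succ, ← mul_assoc, mul_comp, X_comp, ← ih]
      obtain ⟨n₀, h⟩ := act_mul_X_sub hs hX0 hX1 1 (C b * X ^ n)
      rw [h (max n₀ N) (le_max_left _ _), ← hw (max n₀ N) (le_max_right _ _), Finset.mul_sum]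
      refine Finset.sum_congr rfl fun j _ => ?_
      rw [act_one_of_eval_eq_zero hs hb' h0 hX1 _ (eval_alpha_X_eq_zero hs hb' h0 hX1 j)]
      ring

/-- Each factor `X - C c` must absorb at least one unit of the index since `act₀(·, X - c) = 0`; at
index `m` each absorbs exactly one. -/
theorem act_X_sub_pow (hb : UpperBounded s) (h0 : alpha s 0 = 0) (hX1 : alpha s 1 X = C c)
    (p : k[X]) (m : ℕ) : (∀ i < m, act s c i p ((X - C c) ^ m) = 0) ∧
      act s c m p ((X - C c) ^ m) = (fun r => act s c 1 r (X - C c))^[m] p := by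
  induction m with
  | zero =>
    have h := act_C_right hs c 0 p 1
    simp only [C_1, if_true, one_smul] at h
    simp [h]
  | succ m ih =>
    have hz : ∀ u v, v = 0 ∨ u < m →
        act s c v (act s c u p ((X - C c) ^ m)) (X - C c) = 0 := by
      rintro u v (rfl | hu)
      · exact act_zero_X_sub hs hb h0 hX1 _
      · simp [ih.1 u hu]
    constructor
    · intro i hi
      rw [pow_succ, act_mul_right hs]
      refine Finset.sum_eq_zero ?_
      rintro ⟨u, v⟩ huv
      have := Finset.HasAntidiagonal.mem_antidiagonal.1 huv
      exact hz u v (by simp at this; omega)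
    · rw [pow_succ, act_mul_right hs, Function.iterate_succ_apply', ← ih.2,
        Finset.sum_eq_single (m, 1)]
      · rintro ⟨u, v⟩ huv hne
        have := Finset.HasAntidiagonal.mem_antidiagonal.1 huv
        refine hz u v ?_
        simp at this
        by_contra hc
        exact hne (by ext <;> simp <;> omega)
      · simp

theorem eval_derivative_alpha_X_eq_zero (hb : UpperBounded s) (h0 : alpha s 0 = 0)
    (hX1 : alpha s 1 X = C c) (j : ℕ) : (derivative (alpha s (j + 2) X)).eval c = 0 := by
  obtain ⟨w, hw, hcomp⟩ := act_one_X_sub hs hb h0 hX1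
  have hb' := hb
  obtain ⟨N, hN⟩ := hb
  by_contra hne
  rw [← hw] at hne
  have hd : 2 ≤ w.natDegree := le_trans (by omega) (le_natDegree_of_ne_zero hne)
  have hdeg : ∀ m, ((fun r => act s c 1 r (X - C c))^[m] X).natDegree = w.natDegree ^ m := by
    intro m
    induction m with
    | zero => simp
    | succ m ih => rw [Function.iterate_succ_apply', hcomp, natDegree_comp, ih, pow_succ]
  -- The leading coefficient of the `N`-th iterate is a Taylor coefficient of an `α` with index
  -- beyond the bound.
  have hlt : N < w.natDegree ^ N := Nat.lt_pow_self (by omega)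
  have h := hdeg N
  rw [← (act_X_sub_pow hs hb' h0 hX1 X N).2] at h
  have hz : (act s c N X ((X - C c) ^ N)).leadingCoeff = 0 := by
    rw [leadingCoeff, h, coeff_act_X, hN _ hlt.le]
    simp
  rw [leadingCoeff_eq_zero.1 hz, natDegree_zero] at h
  omega

theorem isMultipleRoot_alpha_X (hb : UpperBounded s) (h0 : alpha s 0 = 0)
    (hX1 : alpha s 1 X = C c) {j : ℕ} (hj : 1 < j) : IsMultipleRoot (alpha s j X) c := by
  obtain ⟨j, rfl⟩ := Nat.exists_eq_add_of_le' hj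
  obtain ⟨b, hb'⟩ := dvd_iff_isRoot.2 (eval_alpha_X_eq_zero hs hb h0 hX1 j)
  have h := eval_derivative_alpha_X_eq_zero hs hb h0 hX1 j
  have hr : b.IsRoot c := by simpa [hb'] using h
  rw [IsMultipleRoot, hb', pow_two]
  exact mul_dvd_mul_left _ (dvd_iff_isRoot.2 hr)

/-! ### Uniqueness -/

/-- The gain `g` grows by one per round: stripping a `Y` from `p` loses at most one order, and the
terms of `act_mul_X_sub` return at least two. Boundedness plays no role. -/
theorem X_pow_dvd_act_sub_act {s' : PlaneMap k} (hs' : IsTwistingMap s') (h0 : alpha s 0 = 0)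
    (h0' : alpha s' 0 = 0) (hX1 : alpha s 1 X = C c)
    (hX : ∀ j, alpha s j X = alpha s' j X) (g : ℕ) :
    ∀ (r m : ℕ) (p a : k[X]), X ^ r ∣ p → X ^ (r + g) ∣ act s c m p a - act s' c m p a := by
  have hX0 : alpha s 0 X = 0 := by simp [h0]
  induction g with
  | zero =>
    intro r m p a hp
    exact (X_pow_dvd_act hs h0 _ _ _ hp).sub (X_pow_dvd_act hs' h0' _ _ _ hp)
  | succ g ih =>
    have h1 : ∀ (r m : ℕ) (p : k[X]), X ^ r ∣ p →
        X ^ (r + g + 1) ∣ act s c m p (X - C c) - act s' c m p (X - C c) := by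
      intro r m p hp
      have hp' : X ^ (r - 1) ∣ p.divX := by
        rcases r with _ | r
        · simp
        · have h := X_dvd_iff.1 ((dvd_pow_self X r.succ_ne_zero).trans hp)
          rw [← divX_mul_X_add p, h, C_0, add_zero, pow_succ] at hp
          exact (mul_dvd_mul_iff_right X_ne_zero).1 hp
      obtain ⟨n₁, e₁⟩ := act_mul_X_sub hs hX0 hX1 m p.divX
      obtain ⟨n₂, e₂⟩ := act_mul_X_sub hs' ((hX 0).symm.trans hX0) ((hX 1).symm.trans hX1) m
        p.divX
      have e : act s c m p (X - C c) - act s' c m p (X - C c) =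
          act s c m (p.divX * X) (X - C c) - act s' c m (p.divX * X) (X - C c) := by
        nth_rewrite 1 2 [← divX_mul_X_add p]
        rw [← mul_one (C (p.coeff 0)), ← smul_eq_C_mul]
        simp only [map_add, map_smul, LinearMap.add_apply, LinearMap.smul_apply,
          act_one_left hs, act_one_left hs']
        ring
      rw [e, e₁ _ (le_max_left n₁ n₂), e₂ _ (le_max_right n₁ n₂), ← Finset.sum_sub_distrib]
      refine Finset.dvd_sum fun j _ => ?_
      rw [hX, ← sub_mul]
      refine (pow_dvd_pow X (show r + g + 1 ≤ (r - 1 + g) + (j + 2) by omega)).trans ?_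
      rw [pow_add]
      exact mul_dvd_mul_right (ih _ _ _ _ hp') _
    intro r m p a hp
    have hC : ∀ m p (b : k), act s c m p (C b) - act s' c m p (C b) = 0 := fun m p b => by
      rw [act_C_right hs, act_C_right hs', sub_self]
    have h2 : ∀ (r m : ℕ) (p : k[X]), X ^ r ∣ p →
        X ^ (r + g + 1) ∣ act s c m p X - act s' c m p X := by
      intro r m p hp
      have h := h1 r m p hp
      have := hC m p c
      rw [map_sub, map_sub, sub_sub_sub_comm, this, sub_zero] at h
      exact h
    rw [← add_assoc]
    induction a using Polynomial.induction_on generalizing m with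
    | C b => simp [hC]
    | add a b ha hb =>
      rw [map_add, map_add, add_sub_add_comm]
      exact (ha m).add (hb m)
    | monomial n b iha =>
      rw [pow_succ X n, ← mul_assoc, act_mul_right hs, act_mul_right hs', ← Finset.sum_sub_distrib]
      refine Finset.dvd_sum fun u _ => ?_
      -- Telescope: change the outer action first, then the inner one.
      rw [← sub_add_sub_cancel _ (act s' c u.2 (act s c u.1 p (C b * X ^ n)) X) _,
        ← LinearMap.sub_apply (act s' c u.2 _) (act s' c u.2 _), ← map_sub]
      exact (h2 _ _ _ (X_pow_dvd_act hs h0 _ _ _ hp)).add (X_pow_dvd_act hs' h0' _ _ _ (iha u.1))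

theorem eq_of_apply_X_tmul_X_eq {s' : PlaneMap k} (hs' : IsTwistingMap s')
    (h0 : alpha s 0 = 0) (h0' : alpha s' 0 = 0) (hX1 : alpha s 1 X = C c)
    (h : s (X ⊗ₜ X) = s' (X ⊗ₜ X)) : s = s' := by
  have hX : ∀ j, alpha s j X = alpha s' j X := fun j => congrArg (coeffY j) h
  refine TensorProduct.ext' fun p a => eq_of_slice_eq (c := c) fun m => ?_
  rw [← act_apply, ← act_apply, ← sub_eq_zero]
  ext n
  exact X_pow_dvd_iff.1
    (X_pow_dvd_act_sub_act hs hs' h0 h0' hX1 hX (n + 1) 0 m p a (by simp)) n (by omega)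

end

end TwistedPlane

namespace TwistedPlane

open Polynomial

section

variable {k : Type*} [CommRing k]

/-! ### Existence -/

/-- The map `p ⊗ a ↦ p₀ a ⊗ 1 + a(c) 1 ⊗ (p - p₀) + p₁ a'(c) t`. -/
noncomputable def evalTwist (c : k) (t : k[X] ⊗[k] k[X]) : PlaneMap k :=
  TensorProduct.lift <| LinearMap.mk₂ k
    (fun p a : k[X] => p.coeff 0 • (a ⊗ₜ[k] (1 : k[X])) +
      a.eval c • ((1 : k[X]) ⊗ₜ[k] (p - C (p.coeff 0))) +
      (p.coeff 1 * (derivative a).eval c) • t)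
    (fun p r a => by
      simp only [coeff_add, C_add, add_sub_add_comm, TensorProduct.tmul_add]; module)
    (fun b p a => by
      have h : b • p - C ((b • p).coeff 0) = b • (p - C (p.coeff 0)) := by
        simp [smul_eq_C_mul, mul_sub]
      rw [h, TensorProduct.tmul_smul]
      simp only [coeff_smul, smul_eq_mul]
      module)
    (fun p a b => by
      simp only [eval_add, derivative_add, TensorProduct.add_tmul]; module)
    (fun b p a => by
      simp only [eval_smul, derivative_smul, smul_eq_mul, ← TensorProduct.smul_tmul']; module)

theorem evalTwist_tmul (c : k) (t : k[X] ⊗[k] k[X]) (p a : k[X]) :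
    evalTwist c t (p ⊗ₜ a) = p.coeff 0 • (a ⊗ₜ[k] (1 : k[X])) +
      a.eval c • ((1 : k[X]) ⊗ₜ[k] (p - C (p.coeff 0))) +
      (p.coeff 1 * (derivative a).eval c) • t := rfl

/-- Both step maps act on `t` by scalars. For `leftStep` this uses the double roots of the `Q j`;
for `rightStep` it uses that only powers `Yʲ` with `j ≥ 2` occur, so `p₀` and `p₁` vanish on them.
-/
theorem isTwistingMap_evalTwist {c : k} {t : k[X] ⊗[k] k[X]} {n : ℕ} {Q : ℕ → k[X]}
    (ht : t = ∑ j ∈ Finset.range n, Q j ⊗ₜ[k] (X ^ (j + 2) : k[X]))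
    (hQ : ∀ j, (Q j).eval c = 0) (hQ' : ∀ j, (derivative (Q j)).eval c = 0) :
    IsTwistingMap (evalTwist c t) := by
  have h1 : ∀ a : k[X], evalTwist c t (1 ⊗ₜ a) = a ⊗ₜ 1 := fun a => by
    simp [evalTwist_tmul, coeff_one]
  have h2 : ∀ p : k[X], evalTwist c t (p ⊗ₜ 1) = 1 ⊗ₜ p := fun p => by
    have h : (1 : k[X]) ⊗ₜ[k] C (p.coeff 0) = p.coeff 0 • ((1 : k[X]) ⊗ₜ[k] (1 : k[X])) := by
      rw [← TensorProduct.tmul_smul, smul_eq_C_mul, mul_one]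
    simp [evalTwist_tmul, TensorProduct.tmul_sub, h]
  have hl : ∀ p, leftStep (evalTwist c t) p t = p.coeff 0 • t := by
    intro p
    conv_lhs => rw [ht]
    conv_rhs => rw [ht]
    simp [evalTwist_tmul, hQ, hQ', Finset.smul_sum, mul_smul_comm]
  have hr : ∀ b, rightStep (evalTwist c t) b t = b.eval c • t := by
    intro b
    conv_lhs => rw [ht]
    conv_rhs => rw [ht]
    simp [evalTwist_tmul, Finset.smul_sum, coeff_X_pow, mul_smul_comm]
  refine (isTwistingMap_iff _).2 ⟨h1, h2, fun p r a => ?_, fun p a b => ?_⟩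
  · rw [evalTwist_tmul c t r a]
    simp only [map_add, map_smul, leftStep_tmul, hl, h2, Algebra.TensorProduct.tmul_mul_tmul,
      one_mul, ← Algebra.TensorProduct.one_def]
    have h : (1 : k[X]) ⊗ₜ[k] (p * r - C ((p * r).coeff 0)) =
        r.coeff 0 • ((1 : k[X]) ⊗ₜ[k] (p - C (p.coeff 0))) +
          (1 : k[X]) ⊗ₜ[k] ((r - C (r.coeff 0)) * p) := by
      rw [← TensorProduct.tmul_smul, ← TensorProduct.tmul_add, mul_coeff_zero, C_mul,
        smul_eq_C_mul]
      congr 1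
      ring
    rw [evalTwist_tmul, evalTwist_tmul, h, mul_coeff_zero, mul_coeff_one]
    module
  · rw [evalTwist_tmul c t p a]
    simp only [map_add, map_smul, rightStep_tmul, hr, h1, Algebra.TensorProduct.tmul_mul_tmul,
      one_mul, ← Algebra.TensorProduct.one_def, evalTwist_tmul c t _ b, evalTwist_tmul c t _ (a * b),
      derivative_mul, eval_add, eval_mul, coeff_sub, coeff_C_zero, sub_self, C_0,
      sub_zero, coeff_C_of_ne_zero one_ne_zero]
    module

theorem IsMultipleRoot.eval_eq_zero {p : k[X]} {c : k} (h : IsMultipleRoot p c) :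
    p.eval c = 0 := by
  obtain ⟨b, rfl⟩ := h
  simp

theorem IsMultipleRoot.eval_derivative_eq_zero {p : k[X]} {c : k} (h : IsMultipleRoot p c) :
    (derivative p).eval c = 0 := by
  obtain ⟨b, rfl⟩ := h
  simp [derivative_mul, derivative_pow]

theorem exists_isTwistingMap {t : k[X] ⊗[k] k[X]} {c : k} (h0 : coeffY 0 t = 0)
    (h1 : coeffY 1 t = C c) (h : ∀ j > 1, IsMultipleRoot (coeffY j t) c) :
    ∃ s : PlaneMap k, IsTwistingMap s ∧ UpperBounded s ∧ s (X ⊗ₜ X) = t := by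
  obtain ⟨n, hn⟩ := exists_eq_sum_coeffY t
  -- `t'` is `t` without its part `c ⊗ Y`, which `evalTwist` supplies through its evaluation term.
  set t' := ∑ j ∈ Finset.range n, coeffY (j + 2) t ⊗ₜ[k] (X ^ (j + 2) : k[X]) with ht'
  refine ⟨evalTwist c t', isTwistingMap_evalTwist ht'
    (fun j => (h (j + 2) (by omega)).eval_eq_zero)
    (fun j => (h (j + 2) (by omega)).eval_derivative_eq_zero), ⟨n + 2, fun m hm => ?_⟩, ?_⟩
  · refine LinearMap.ext fun a => ?_
    have hz : ∀ j ∈ Finset.range n, coeffY m (coeffY (j + 2) t ⊗ₜ[k] (X ^ (j + 2) : k[X])) = 0 := by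
      intro j hj
      have : m ≠ j + 2 := by
        have := Finset.mem_range.1 hj
        omega
      simp [coeff_X_pow, this]
    have hX : (X : k[X]).coeff m = 0 := coeff_X_of_ne_one (by omega)
    have ht0 : coeffY m t' = 0 := by rw [ht', map_sum, Finset.sum_eq_zero hz]
    simp [alpha, evalTwist_tmul, ht0, hX]
  · have e := hn (n + 2) (by omega)
    rw [Finset.sum_range_succ', Finset.sum_range_succ', h0, zero_add, h1, TensorProduct.zero_tmul,
      add_zero, pow_one] at e
    rw [e, evalTwist_tmul, ← mul_one (C c), ← smul_eq_C_mul, ← TensorProduct.smul_tmul']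
    simp only [add_assoc, Nat.reduceAdd, ← ht']
    simp [add_comm]

/-! ### Translation to coefficients and conclusion -/

theorem upperCond_iff (q : ℕ × ℕ →₀ k) (c : k) :
    UpperCond q ∧ q (0, 1) = c ↔ colPoly q 0 = 0 ∧ colPoly q 1 = C c := by
  simp only [Polynomial.ext_iff, coeff_colPoly, UpperCond, coeff_zero, and_assoc]
  refine and_congr_right fun _ => ⟨fun ⟨h, hc⟩ i => ?_, fun h => ⟨fun i hi => ?_, by simpa using h 0⟩⟩
  · rcases i with _ | i
    · simp [hc]
    · simp [h (i + 1) (by omega)]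
  · rw [h i, coeff_C, if_neg (by omega)]

theorem alpha_X_eq_colPoly {s : PlaneMap k} {q : ℕ × ℕ →₀ k} (h : s (X ⊗ₜ X) = tensorOf q)
    (j : ℕ) : alpha s j X = colPoly q j := by
  rw [← coeffY_tensorOf, ← h]
  rfl

theorem alphaZeroEval_iff {s : PlaneMap k} (hs : IsTwistingMap s) {q : ℕ × ℕ →₀ k}
    (h : s (X ⊗ₜ X) = tensorOf q) (c : k) :
    AlphaZeroEval s c ↔ UpperCond q ∧ q (0, 1) = c := by
  rw [upperCond_iff, ← alpha_X_eq_colPoly h, ← alpha_X_eq_colPoly h]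
  refine ⟨fun ⟨h0, h1⟩ => ⟨by simp [h0], by simp [h1]⟩, fun ⟨h0, h1⟩ =>
    ⟨alpha_zero_eq_zero hs h0 h1, alpha_one_eq_eval hs h0 h1⟩⟩

theorem exists_upperBounded {q : ℕ × ℕ →₀ k} (hq : UpperCond q)
    (h : ∀ j > 1, IsMultipleRoot (colPoly q j) (q (0, 1))) :
    ∃ s : PlaneMap k, IsTwistingMap s ∧ UpperBounded s ∧ s (X ⊗ₜ X) = tensorOf q := by
  obtain ⟨h0, h1⟩ := (upperCond_iff q _).1 ⟨hq, rfl⟩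
  exact exists_isTwistingMap (by rw [coeffY_tensorOf, h0]) (by rw [coeffY_tensorOf, h1])
    fun j hj => by rw [coeffY_tensorOf]; exact h j hj

end

section

variable {k : Type*} [CommRing k] [IsDomain k]

theorem isMultipleRoot_colPoly {s : PlaneMap k} (hs : IsTwistingMap s) (hb : UpperBounded s)
    {q : ℕ × ℕ →₀ k} (h : s (X ⊗ₜ X) = tensorOf q) {c : k} (hc : AlphaZeroEval s c) {j : ℕ}
    (hj : 1 < j) : IsMultipleRoot (colPoly q j) c := by
  rw [← alpha_X_eq_colPoly h]
  exact isMultipleRoot_alpha_X hs hb hc.1 (by simp [hc.2]) hj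

theorem exists_upperBounded_iff {q : ℕ × ℕ →₀ k} (hq : UpperCond q) :
    (∃ s : PlaneMap k, IsTwistingMap s ∧ UpperBounded s ∧ s (X ⊗ₜ X) = tensorOf q) ↔
      ∀ j > 1, IsMultipleRoot (colPoly q j) (q (0, 1)) :=
  ⟨fun ⟨_, hs, hb, h⟩ _ hj =>
    isMultipleRoot_colPoly hs hb h ((alphaZeroEval_iff hs h _).2 ⟨hq, rfl⟩) hj,
    exists_upperBounded hq⟩

theorem exists_lowerBounded_iff {q : ℕ × ℕ →₀ k} (hq : LowerCond q) :
    (∃ s : PlaneMap k, IsTwistingMap s ∧ LowerBounded s ∧ s (X ⊗ₜ X) = tensorOf q) ↔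
      ∀ i > 1, IsMultipleRoot (rowPoly q i) (q (1, 0)) := by
  have hq' : UpperCond (q.mapDomain Prod.swap) := by
    simpa only [UpperCond, LowerCond, mapDomain_swap_apply] using hq
  have h := exists_upperBounded_iff hq'
  simp only [colPoly_mapDomain_swap, mapDomain_swap_apply] at h
  rw [← h]
  constructor
  · rintro ⟨s, hs, hb, e⟩
    exact ⟨flipConj s, hs.flipConj, hb, by rw [flipConj_tmul, e, comm_tensorOf]⟩
  · rintro ⟨s, hs, hb, e⟩
    refine ⟨flipConj s, hs.flipConj, by rwa [LowerBounded, flipConj_flipConj], ?_⟩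
    rw [flipConj_tmul, e, ← comm_tensorOf]
    exact (TensorProduct.comm k k[X] k[X]).symm_apply_apply (tensorOf q)

theorem bijOn_apply_X_tmul_X (c : k) : Set.BijOn (fun s : PlaneMap k => s (X ⊗ₜ X))
    {s | IsTwistingMap s ∧ UpperBounded s ∧ AlphaZeroEval s c}
    {t | ∃ q : ℕ × ℕ →₀ k, t = tensorOf q ∧ UpperCond q ∧ q (0, 1) = c ∧
      ∀ j > 1, IsMultipleRoot (colPoly q j) c} := by
  refine ⟨?_, ?_, ?_⟩
  · rintro s ⟨hs, hb, hc⟩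
    obtain ⟨q, hq⟩ := exists_eq_tensorOf (s (X ⊗ₜ X))
    obtain ⟨h1, h2⟩ := (alphaZeroEval_iff hs hq c).1 hc
    exact ⟨q, hq, h1, h2, fun j hj => isMultipleRoot_colPoly hs hb hq hc hj⟩
  · rintro s ⟨hs, -, hc⟩ s' ⟨hs', -, hc'⟩ h
    exact eq_of_apply_X_tmul_X_eq hs hs' hc.1 hc'.1 (c := c) (by simp [hc.2]) h
  · rintro _ ⟨q, rfl, hq, rfl, h⟩
    obtain ⟨s, hs, hb, e⟩ := exists_upperBounded hq h
    exact ⟨s, ⟨hs, hb, (alphaZeroEval_iff hs e _).2 ⟨hq, rfl⟩⟩, e⟩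

end

end TwistedPlane
theorem corollary3p6 {k : Type*} [CommRing k] [IsDomain k] :
    (∀ q : ℕ × ℕ →₀ k, TwistedPlane.UpperCond q →
      ((∃ s : TwistedPlane.PlaneMap k, IsTwistingMap s ∧ TwistedPlane.UpperBounded s ∧
          s ((Polynomial.X : k[X]) ⊗ₜ[k] (Polynomial.X : k[X])) = TwistedPlane.tensorOf q) ↔
        ∀ j > 1, TwistedPlane.IsMultipleRoot (TwistedPlane.colPoly q j) (q (0, 1)))) ∧
    (∀ q : ℕ × ℕ →₀ k, TwistedPlane.LowerCond q →
      ((∃ s : TwistedPlane.PlaneMap k, IsTwistingMap s ∧ TwistedPlane.LowerBounded s ∧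
          s ((Polynomial.X : k[X]) ⊗ₜ[k] (Polynomial.X : k[X])) = TwistedPlane.tensorOf q) ↔
        ∀ i > 1, TwistedPlane.IsMultipleRoot (TwistedPlane.rowPoly q i) (q (1, 0)))) ∧
    (∀ (s : TwistedPlane.PlaneMap k) (q : ℕ × ℕ →₀ k) (c : k),
      IsTwistingMap s → TwistedPlane.UpperBounded s →
      s ((Polynomial.X : k[X]) ⊗ₜ[k] (Polynomial.X : k[X])) = TwistedPlane.tensorOf q →
      (TwistedPlane.AlphaZeroEval s c ↔ TwistedPlane.UpperCond q ∧ q (0, 1) = c)) ∧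
    (∀ c : k, Set.BijOn
      (fun s : TwistedPlane.PlaneMap k => s ((Polynomial.X : k[X]) ⊗ₜ[k] (Polynomial.X : k[X])))
      {s | IsTwistingMap s ∧ TwistedPlane.UpperBounded s ∧ TwistedPlane.AlphaZeroEval s c}
      {t | ∃ q : ℕ × ℕ →₀ k, t = TwistedPlane.tensorOf q ∧ TwistedPlane.UpperCond q ∧
        q (0, 1) = c ∧ ∀ j > 1, TwistedPlane.IsMultipleRoot (TwistedPlane.colPoly q j) c}) :=
  ⟨fun _ hq => TwistedPlane.exists_upperBounded_iff hq,
    fun _ hq => TwistedPlane.exists_lowerBounded_iff hq,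
    fun _ _ c hs _ h => TwistedPlane.alphaZeroEval_iff hs h c,
    TwistedPlane.bijOn_apply_X_tmul_X⟩
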